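/- Let $p$ be a prime, let $G$ be a profinite group and let $S\le G$ be a Sylow pro-$p$ subgroup, that is, a closed pro-$p$ subgroup whose (supernatural) index $[G:S]$ is prime to $p$. Let $H^*_c(-)=H^*_c(-;\mathbb{F}_p)=\bigoplus_{n\ge 0}H^n_c(-;\mathbb{F}_p)$ be the continuous cohomology ring (with cup product) with coefficients in the trivial module $\mathbb{F}_p$. Let $\mathcal{F}_S(G)$ be the category whose objects are the closed subgroups of $S$ and whose morphisms $P\to Q$ are the homomorphisms of the form $x\mapsto gxg^{-1}$ with $g\in G$, $gPg^{-1}\le Q$, and let $\mathcal{F}_S(G)^\circ$ be its full subcategory on the open subgroups of $S$. An element $x\in H^*_c(S)$ is called $\mathcal{F}_S(G)$-stable (resp. $\mathcal{F}_S(G)^\circ$-stable) if $\varphi^*(x)=\mathrm{res}^S_P(x)$ for every closed (resp. open) subgroup $P\le S$ and every morphism $\varphi\colon P\to S$ of $\mathcal{F}_S(G)$; these elements form subrings $H^*_c(S;\mathbb{F}_p)^{\mathcal{F}_S(G)}$ and $H^*_c(S;\mathbb{F}_p)^{\mathcal{F}_S(G)^\circ}$ of $H^*_c(S;\mathbb{F}_p)$.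 Then there is a ring isomorphism, given by the restriction map $\mathrm{res}^G_S$, \[ H^*_c(G;\mathbb{F}_p)\;\cong\; H^*_c(S;\mathbb{F}_p)^{\mathcal{F}_S(G)} , \] and, as subrings of $H^*_c(S;\mathbb{F}_p)$, \[ H^*_c(S;\mathbb{F}_p)^{\mathcal{F}_S(G)} = H^*_c(S;\mathbb{F}_p)^{\mathcal{F}_S(G)^\circ}. \] -/

import Mathlib

/-! ## The continuous mod-`p` cohomology ring of a topological group -/

namespace ContCoh

open scoped DirectSum

universe u v

section Cochains

variable (p : ℕ) (G : Type u) [Group G] [TopologicalSpace G]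

/-- Continuous homogeneous `n`-cochains of `G` with coefficients in the trivial module `𝔽_p` (with
its discrete topology): continuous maps `f : G^{n+1} → 𝔽_p` such that
`f (g x₀, …, g xₙ) = f (x₀, …, xₙ)`. -/
def Cochain (n : ℕ) : Submodule (ZMod p) ((Fin (n + 1) → G) → ZMod p) where
  carrier := {f | Continuous f ∧ ∀ (g : G) (x : Fin (n + 1) → G), f (fun i => g * x i) = f x}
  add_mem' := fun ha hb => ⟨ha.1.add hb.1, fun g x => by
    simp only [Pi.add_apply, ha.2 g x, hb.2 g x]⟩
  zero_mem' := ⟨continuous_const, fun _ _ => rfl⟩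
  smul_mem' := fun c _ ha => ⟨ha.1.const_smul c, fun g x => by
    simp only [Pi.smul_apply, ha.2 g x]⟩

variable {p G}

/-- The coboundary `(d f) (x₀, …, xₙ₊₁) = ∑ i, (-1)^i f (x₀, …, x̂ᵢ, …, xₙ₊₁)`. -/
def d (n : ℕ) : Cochain p G n →ₗ[ZMod p] Cochain p G (n + 1) where
  toFun f := ⟨fun x => ∑ i : Fin (n + 2), (-1) ^ (i : ℕ) * f.1 (fun j => x (i.succAbove j)),
    continuous_finsetSum _ fun i _ => continuous_const.mul
      (f.2.1.comp (continuous_pi fun j => continuous_apply _)),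
    fun g x => Finset.sum_congr rfl fun i _ => by
      rw [f.2.2 g (fun j => x (i.succAbove j))]⟩
  map_add' f h := by
    ext x
    simp [mul_add, Finset.sum_add_distrib]
  map_smul' c f := by
    ext x
    simp [Finset.mul_sum, mul_left_comm]

/-- The cup product of cochains,
`(f ∪ h) (x₀, …, xₘ₊ₙ) = f (x₀, …, xₘ) * h (xₘ, …, xₘ₊ₙ)`. -/
def cup {m n : ℕ} (f : Cochain p G m) (h : Cochain p G n) : Cochain p G (m + n) :=
  ⟨fun x => f.1 (fun i => x ⟨i, by omega⟩) * h.1 (fun j => x ⟨m + j, by omega⟩),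
    (f.2.1.comp (continuous_pi fun _ => continuous_apply _)).mul
      (h.2.1.comp (continuous_pi fun _ => continuous_apply _)),
    fun g x => congrArg₂ (· * ·) (f.2.2 g (fun i => x ⟨i, by omega⟩))
      (h.2.2 g (fun j => x ⟨m + j, by omega⟩))⟩

variable (p G) in
/-- The constant `0`-cochain `1`. -/
def one : Cochain p G 0 := ⟨fun _ => 1, continuous_const, fun _ _ => rfl⟩

variable (p G) in
/-- The `n`-cocycles. -/
abbrev Cocycle (n : ℕ) : Submodule (ZMod p) (Cochain p G n) := LinearMap.ker (d n)

variable (p G) in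
/-- The `n`-coboundaries. -/
def coboundaries : (n : ℕ) → Submodule (ZMod p) (Cochain p G n)
  | 0 => ⊥
  | n + 1 => LinearMap.range (d n)

variable (p G) in
/-- `Hⁿ_c(G; 𝔽_p)`, cocycles modulo coboundaries. -/
def Hn (n : ℕ) : Type u := Cocycle p G n ⧸ (coboundaries p G n).submoduleOf (Cocycle p G n)

instance (n : ℕ) : AddCommGroup (Hn p G n) :=
  inferInstanceAs (AddCommGroup
    (Cocycle p G n ⧸ (coboundaries p G n).submoduleOf (Cocycle p G n)))

instance (n : ℕ) : Module (ZMod p) (Hn p G n) :=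
  inferInstanceAs (Module (ZMod p)
    (Cocycle p G n ⧸ (coboundaries p G n).submoduleOf (Cocycle p G n)))

variable (p G) in
/-- The total cohomology `H^*_c(G; 𝔽_p) = ⨁ₙ Hⁿ_c(G; 𝔽_p)`. -/
abbrev H : Type u := ⨁ n, Hn p G n

/-! ### Compatibility of the cup product with coboundaries -/

/-- Evaluation of a cochain on an infinite sequence (only the first `n + 1` terms matter). -/
def ev {n : ℕ} (f : Cochain p G n) (y : ℕ → G) : ZMod p := f.1 (fun i => y i)

/-- Omit the `i`-th term of a sequence. -/
def face (i : ℕ) (y : ℕ → G) : ℕ → G := fun j => if j < i then y j else y (j + 1)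

theorem exists_seq {A : Type*} {n : ℕ} (x : Fin (n + 1) → A) :
    ∃ y : ℕ → A, x = fun i : Fin (n + 1) => y i :=
  ⟨fun i => if h : i < n + 1 then x ⟨i, h⟩ else x 0, by
    funext i
    simp only [i.2, dite_true]⟩

theorem cochain_ext {n : ℕ} {f h : Cochain p G n} (w : ∀ y, ev f y = ev h y) : f = h := by
  apply Subtype.ext
  funext x
  obtain ⟨y, rfl⟩ := exists_seq x
  exact w y

theorem ev_congr {n : ℕ} (f : Cochain p G n) {y z : ℕ → G} (w : ∀ i < n + 1, y i = z i) :
    ev f y = ev f z := by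
  exact congrArg f.1 (funext fun i => w i i.2)

theorem ev_add {n : ℕ} (f h : Cochain p G n) (y : ℕ → G) : ev (f + h) y = ev f y + ev h y := rfl

theorem ev_smul {n : ℕ} (c : ZMod p) (f : Cochain p G n) (y : ℕ → G) :
    ev (c • f) y = c * ev f y := rfl

theorem ev_d {n : ℕ} (f : Cochain p G n) (y : ℕ → G) :
    ev (d n f) y = ∑ i ∈ Finset.range (n + 2), (-1) ^ i * ev f (face i y) := by
  rw [← Fin.sum_univ_eq_sum_range (fun i => (-1 : ZMod p) ^ i * ev f (face i y)) (n + 2)]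
  change ∑ i : Fin (n + 2), (-1) ^ (i : ℕ) * f.1 (fun j => y (i.succAbove j : Fin (n + 2))) = _
  refine Finset.sum_congr rfl fun i _ => ?_
  refine congrArg (fun z => (-1 : ZMod p) ^ (i : ℕ) * f.1 z) (funext fun j => ?_)
  unfold face
  by_cases hj : (j : ℕ) < i
  · rw [if_pos hj, Fin.succAbove_of_castSucc_lt _ _ (by simpa [Fin.lt_def] using hj)]
    rfl
  · rw [if_neg hj, Fin.succAbove_of_le_castSucc _ _ (by simpa [Fin.le_def] using hj)]
    rfl

theorem ev_cup {m n : ℕ} (f : Cochain p G m) (h : Cochain p G n) (y : ℕ → G) :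
    ev (cup f h) y = ev f y * ev h (fun j => y (m + j)) := rfl

/-- The Leibniz rule. -/
theorem ev_d_cup {m n : ℕ} (f : Cochain p G m) (h : Cochain p G n) (y : ℕ → G) :
    ev (d (m + n) (cup f h)) y =
      ev (cup (d m f) h) y + (-1) ^ m * ev (cup f (d n h)) y := by
  simp only [ev_d, ev_cup]
  rw [show m + n + 2 = (m + 1) + (n + 1) by omega, Finset.sum_range_add,
    Finset.sum_range_succ _ (m + 1), Finset.sum_range_succ' _ (n + 1)]
  have h1 : ∀ i ∈ Finset.range (m + 1),
      (-1 : ZMod p) ^ i * (ev f (face i y) * ev h (fun j => face i y (m + j))) =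
        (-1) ^ i * ev f (face i y) * ev h (fun j => y (m + 1 + j)) := by
    intro i hi
    rw [Finset.mem_range] at hi
    have : (fun j => face i y (m + j)) = fun j => y (m + 1 + j) := by
      funext j
      unfold face
      rw [if_neg (by omega)]
      congr 1
      omega
    rw [this, mul_assoc]
  have h2 : ∀ j ∈ Finset.range (n + 1),
      (-1 : ZMod p) ^ (m + 1 + j) *
        (ev f (face (m + 1 + j) y) * ev h (fun l => face (m + 1 + j) y (m + l))) =
        (-1) ^ m * (ev f y * ((-1) ^ (j + 1) * ev h (face (j + 1) (fun l => y (m + l))))) := by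
    intro j _
    have e1 : ev f (face (m + 1 + j) y) = ev f y := by
      apply ev_congr
      intro i hi
      unfold face
      rw [if_pos (by omega)]
    have e2 : (fun l => face (m + 1 + j) y (m + l)) = face (j + 1) (fun l => y (m + l)) := by
      funext l
      unfold face
      by_cases hl : l < j + 1
      · rw [if_pos hl, if_pos (by omega)]
      · rw [if_neg hl, if_neg (by omega)]
        congr 1
    rw [e1, e2]
    ring
  have e3 : ev f (face (m + 1) y) = ev f y := by
    apply ev_congr
    intro i hi
    unfold face
    rw [if_pos (by omega)]
  have e4 : face 0 (fun l => y (m + l)) = fun j => y (m + 1 + j) := by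
    funext l
    unfold face
    rw [if_neg (Nat.not_lt_zero l)]
    exact congrArg y (by omega)
  rw [Finset.sum_congr rfl h1, Finset.sum_congr rfl h2, e3, e4, add_mul, Finset.sum_mul, mul_add,
    mul_add, Finset.mul_sum, Finset.mul_sum]
  ring

theorem mem_coboundaries_congr {m n : ℕ} (e : m = n) {f : Cochain p G m} {h : Cochain p G n}
    (w : ∀ y, ev f y = ev h y) (hf : f ∈ coboundaries p G m) : h ∈ coboundaries p G n := by
  subst e
  rwa [← cochain_ext w]

theorem ev_zero {n : ℕ} (y : ℕ → G) : ev (0 : Cochain p G n) y = 0 := rfl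

theorem d_d {n : ℕ} (f : Cochain p G n) : d (n + 1) (d n f) = 0 := by
  apply cochain_ext
  intro y
  simp only [ev_d, ev_zero, Finset.mul_sum, ← Finset.sum_product']
  refine Finset.sum_involution
    (fun a _ => if a.1 ≤ a.2 then (a.2 + 1, a.1) else (a.2, a.1 - 1)) ?_ ?_ ?_ ?_
  · rintro ⟨i, j⟩ _
    by_cases h : i ≤ j
    · have e : face j (face i y) = face i (face (j + 1) y) := by
        funext l
        unfold face
        split_ifs <;> first | rfl | omega
      simp only [h, if_true]
      rw [e]
      ring
    · obtain ⟨k, rfl⟩ : ∃ k, i = k + 1 := ⟨i - 1, by omega⟩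
      have e : face j (face (k + 1) y) = face k (face j y) := by
        funext l
        unfold face
        split_ifs <;> first | rfl | omega
      simp only [h, if_false, Nat.add_sub_cancel]
      rw [e]
      ring
  · rintro ⟨i, j⟩ _ _
    by_cases h : i ≤ j <;> simp [h] <;> omega
  · rintro ⟨i, j⟩ hm
    simp only [Finset.mem_product, Finset.mem_range] at hm
    by_cases h : i ≤ j <;> simp only [h, if_true, if_false, Finset.mem_product,
      Finset.mem_range] <;> omega
  · rintro ⟨i, j⟩ _
    by_cases h : i ≤ j
    · simp [h]
    · have h1 : j ≤ i - 1 := by omega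
      simp only [h, if_false, h1, if_true, Prod.mk.injEq, and_true]
      omega

theorem coboundaries_le_cocycle (n : ℕ) : coboundaries p G n ≤ Cocycle p G n := by
  cases n with
  | zero => exact bot_le
  | succ n =>
    rintro _ ⟨f, rfl⟩
    exact LinearMap.mem_ker.mpr (d_d f)

theorem cup_mem_cocycle {m n : ℕ} (f : Cocycle p G m) (h : Cocycle p G n) :
    cup f.1 h.1 ∈ Cocycle p G (m + n) := by
  rw [LinearMap.mem_ker]
  apply cochain_ext
  intro y
  rw [ev_d_cup, LinearMap.mem_ker.mp f.2, LinearMap.mem_ker.mp h.2]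
  simp [ev_cup, ev_zero]

theorem one_mem_cocycle : one p G ∈ Cocycle p G 0 := by
  rw [LinearMap.mem_ker]
  apply cochain_ext
  intro y
  rw [ev_d]
  simp [ev, one, Finset.sum_range_succ]

theorem coboundary_cup {m n : ℕ} {f : Cochain p G m} (hf : f ∈ coboundaries p G m)
    {h : Cochain p G n} (hh : h ∈ Cocycle p G n) : cup f h ∈ coboundaries p G (m + n) := by
  cases m with
  | zero =>
    rw [coboundaries, Submodule.mem_bot] at hf
    have : cup f h = 0 := by
      apply cochain_ext
      intro y
      simp [hf, ev_cup, ev_zero]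
    rw [this]
    exact Submodule.zero_mem _
  | succ m =>
    obtain ⟨a, rfl⟩ := hf
    refine mem_coboundaries_congr (m := m + n + 1) (by omega) (f := d (m + n) (cup a h)) ?_ ⟨_, rfl⟩
    intro y
    rw [ev_d_cup, LinearMap.mem_ker.mp hh]
    simp [ev_cup, ev_zero]

theorem cup_coboundary {m n : ℕ} {f : Cochain p G m} (hf : f ∈ Cocycle p G m)
    {h : Cochain p G n} (hh : h ∈ coboundaries p G n) : cup f h ∈ coboundaries p G (m + n) := by
  cases n with
  | zero =>
    rw [coboundaries, Submodule.mem_bot] at hh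
    have : cup f h = 0 := by
      apply cochain_ext
      intro y
      simp [hh, ev_cup, ev_zero]
    rw [this]
    exact Submodule.zero_mem _
  | succ n =>
    obtain ⟨a, rfl⟩ := hh
    refine ⟨((-1 : ZMod p) ^ m) • cup f a, ?_⟩
    apply cochain_ext
    intro y
    have hl := ev_d_cup f a y
    rw [LinearMap.mem_ker.mp hf] at hl
    rw [map_smul, ev_smul]
    refine (congrArg _ hl).trans ?_
    have : ((-1 : ZMod p) ^ m) * (-1) ^ m = 1 := by
      rw [← mul_pow]
      simp
    simp only [ev_cup, ev_zero, zero_mul, zero_add, ← mul_assoc, this, one_mul]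

/-! ### The cohomology ring -/

/-- The cup product of cocycles. -/
def cocycleCup {m n : ℕ} (f : Cocycle p G m) (h : Cocycle p G n) : Cocycle p G (m + n) :=
  ⟨cup f.1 h.1, cup_mem_cocycle f h⟩

/-- The class of a cocycle. -/
def cls {n : ℕ} (f : Cocycle p G n) : Hn p G n := Submodule.Quotient.mk f

theorem cls_eq_cls {n : ℕ} {f h : Cocycle p G n} :
    cls f = cls h ↔ f.1 - h.1 ∈ coboundaries p G n :=
  Submodule.Quotient.eq _

theorem cls_add {n : ℕ} (f h : Cocycle p G n) : cls (f + h) = cls f + cls h := rfl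

/-- The cup product `Hᵐ × Hⁿ → Hᵐ⁺ⁿ`. -/
def hcup {m n : ℕ} (a : Hn p G m) (b : Hn p G n) : Hn p G (m + n) :=
  Quotient.liftOn₂' a b (fun f h => cls (cocycleCup f h)) (by
    intro f h f' h' hf hh
    have hf' := cls_eq_cls.mp (Quotient.sound' hf : cls f = cls f')
    have hh' := cls_eq_cls.mp (Quotient.sound' hh : cls h = cls h')
    rw [cls_eq_cls]
    have e : (cocycleCup f h).1 - (cocycleCup f' h').1 =
        cup (f.1 - f'.1) h.1 + cup f'.1 (h.1 - h'.1) := by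
      apply Subtype.ext
      funext x
      simp only [cocycleCup, cup, AddSubgroupClass.coe_sub, Pi.sub_apply, Submodule.coe_add,
        Pi.add_apply]
      ring
    rw [e]
    exact Submodule.add_mem _ (coboundary_cup hf' h.2) (cup_coboundary f'.2 hh'))

theorem hcup_cls {m n : ℕ} (f : Cocycle p G m) (h : Cocycle p G n) :
    hcup (cls f) (cls h) = cls (cocycleCup f h) := rfl

theorem cls_surjective {n : ℕ} (a : Hn p G n) : ∃ f : Cocycle p G n, cls f = a :=
  Submodule.Quotient.mk_surjective _ a

theorem cls_mk_eq {m n : ℕ} (e : m = n) {f : Cocycle p G m} {h : Cocycle p G n}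
    (w : ∀ y, ev f.1 y = ev h.1 y) :
    (GradedMonoid.mk m (cls f) : GradedMonoid (Hn p G)) = GradedMonoid.mk n (cls h) := by
  subst e
  rw [Subtype.ext (cochain_ext w)]

instance : GradedMonoid.GMul (Hn p G) := ⟨hcup⟩

instance : GradedMonoid.GOne (Hn p G) := ⟨cls ⟨one p G, one_mem_cocycle⟩⟩

instance : GradedMonoid.GMonoid (Hn p G) where
  one_mul := by
    rintro ⟨n, a⟩
    obtain ⟨f, rfl⟩ := cls_surjective a
    refine cls_mk_eq (f := cocycleCup ⟨one p G, one_mem_cocycle⟩ f) (zero_add n) fun y => ?_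
    simp [cocycleCup, cup, ev, one]
  mul_one := by
    rintro ⟨n, a⟩
    obtain ⟨f, rfl⟩ := cls_surjective a
    refine cls_mk_eq (f := cocycleCup f ⟨one p G, one_mem_cocycle⟩) (add_zero n) fun y => ?_
    simp [cocycleCup, cup, ev, one]
  mul_assoc := by
    rintro ⟨l, a⟩ ⟨m, b⟩ ⟨n, c⟩
    obtain ⟨f, rfl⟩ := cls_surjective a
    obtain ⟨g, rfl⟩ := cls_surjective b
    obtain ⟨h, rfl⟩ := cls_surjective c
    refine cls_mk_eq (f := cocycleCup (cocycleCup f g) h) (h := cocycleCup f (cocycleCup g h))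
      (add_assoc l m n) fun y => ?_
    simp [cocycleCup, ev_cup, mul_assoc, add_assoc]

theorem hcup_add {m n : ℕ} (a : Hn p G m) (b c : Hn p G n) :
    hcup a (b + c) = hcup a b + hcup a c := by
  obtain ⟨f, rfl⟩ := cls_surjective a
  obtain ⟨g, rfl⟩ := cls_surjective b
  obtain ⟨h, rfl⟩ := cls_surjective c
  rw [← cls_add, hcup_cls, hcup_cls, hcup_cls, ← cls_add]
  congr 1
  apply Subtype.ext
  apply cochain_ext
  intro y
  simp [cocycleCup, ev_cup, ev_add, mul_add]

theorem add_hcup {m n : ℕ} (a b : Hn p G m) (c : Hn p G n) :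
    hcup (a + b) c = hcup a c + hcup b c := by
  obtain ⟨f, rfl⟩ := cls_surjective a
  obtain ⟨g, rfl⟩ := cls_surjective b
  obtain ⟨h, rfl⟩ := cls_surjective c
  rw [← cls_add, hcup_cls, hcup_cls, hcup_cls, ← cls_add]
  congr 1
  apply Subtype.ext
  apply cochain_ext
  intro y
  simp [cocycleCup, ev_cup, ev_add, add_mul]

/-- The graded ring structure on `H^*_c(G; 𝔽_p)` given by the cup product; Mathlib derives from it
the ring structure on `H p G = ⨁ n, Hn p G n`. -/
instance : DirectSum.GRing (Hn p G) where
  mul_zero {_ n} a := by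
    have h := hcup_add a (0 : Hn p G n) 0
    rwa [add_zero, left_eq_add] at h
  zero_mul {m _} b := by
    have h := add_hcup (0 : Hn p G m) 0 b
    rwa [add_zero, left_eq_add] at h
  mul_add := hcup_add
  add_mul := add_hcup
  natCast k := k • cls ⟨one p G, one_mem_cocycle⟩
  natCast_zero := zero_smul _ _
  natCast_succ k := by rw [add_smul, one_smul]; rfl
  intCast k := k • cls ⟨one p G, one_mem_cocycle⟩
  intCast_ofNat k := natCast_zsmul _ _
  intCast_negSucc_ofNat k := negSucc_zsmul _ _

end Cochains

/-! ### Functoriality -/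

section Functoriality

variable {p : ℕ} {G : Type u} {K : Type v} [Group G] [TopologicalSpace G] [Group K] [TopologicalSpace K]

/-- Pullback of cochains along a continuous homomorphism. -/
def cochainMap (φ : K →ₜ* G) (n : ℕ) : Cochain p G n →ₗ[ZMod p] Cochain p K n where
  toFun f := ⟨fun x => f.1 (fun i => φ (x i)),
    f.2.1.comp (continuous_pi fun i => φ.continuous_toFun.comp (continuous_apply i)),
    fun g x => by simpa only [map_mul] using f.2.2 (φ g) (fun i => φ (x i))⟩
  map_add' _ _ := rfl
  map_smul' _ _ := rfl

theorem d_cochainMap (φ : K →ₜ* G) (n : ℕ) (f : Cochain p G n) :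
    d n (cochainMap φ n f) = cochainMap φ (n + 1) (d n f) := rfl

/-- Pullback of cocycles along a continuous homomorphism. -/
def cocycleMap (φ : K →ₜ* G) (n : ℕ) : Cocycle p G n →ₗ[ZMod p] Cocycle p K n :=
  (cochainMap φ n).restrict fun f hf => by
    rw [LinearMap.mem_ker] at hf ⊢
    rw [d_cochainMap, hf, map_zero]

theorem cochainMap_mem_coboundaries (φ : K →ₜ* G) {n : ℕ} {f : Cochain p G n}
    (hf : f ∈ coboundaries p G n) : cochainMap φ n f ∈ coboundaries p K n := by
  cases n with
  | zero =>
    rw [coboundaries, Submodule.mem_bot] at hf ⊢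
    rw [hf, map_zero]
  | succ n =>
    obtain ⟨a, rfl⟩ := hf
    exact ⟨cochainMap φ n a, d_cochainMap φ n a⟩

/-- The map `φ^* : Hⁿ_c(G; 𝔽_p) → Hⁿ_c(K; 𝔽_p)` induced by `φ : K → G`. -/
def HnMap (φ : K →ₜ* G) (n : ℕ) : Hn p G n →ₗ[ZMod p] Hn p K n :=
  Submodule.mapQ _ _ (cocycleMap φ n) fun _ hf => cochainMap_mem_coboundaries φ hf

variable (p) in
/-- The ring homomorphism `φ^* : H^*_c(G; 𝔽_p) → H^*_c(K; 𝔽_p)` induced by `φ : K → G`. -/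
def HMap (φ : K →ₜ* G) : H p G →+* H p K :=
  DirectSum.toSemiring
    (fun n => (DirectSum.of (Hn p K) n).comp (HnMap φ n).toAddMonoidHom)
    rfl
    (by
      intro m n a b
      obtain ⟨f, rfl⟩ := cls_surjective a
      obtain ⟨h, rfl⟩ := cls_surjective b
      simp only [AddMonoidHom.comp_apply]
      rw [DirectSum.of_mul_of]
      rfl)

end Functoriality

end ContCoh

/-! ## Sylow pro-`p` subgroups, the pro-fusion system of a profinite group, stable elements -/

/-- The inclusion of a subgroup, as a continuous homomorphism. -/
def Subgroup.contSubtype {G : Type*} [Group G] [TopologicalSpace G] (S : Subgroup G) : S →ₜ* G :=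
  ⟨S.subtype, continuous_subtype_val⟩

/-- A profinite group is pro-`p` if each of its open normal subgroups has index a power of `p`. -/
def IsProP (p : ℕ) (P : Type*) [Group P] [TopologicalSpace P] : Prop :=
  ∀ N : Subgroup P, N.Normal → IsOpen (N : Set P) → ∃ k : ℕ, N.index = p ^ k

/-- `S` is a Sylow pro-`p` subgroup of the profinite group `G`: a closed pro-`p` subgroup whose
(supernatural) index, the least common multiple of the indices `[G : SN] = [G/N : SN/N]` for `N`
open normal in `G`, is prime to `p`. -/
structure IsSylowProP (p : ℕ) {G : Type*} [Group G] [TopologicalSpace G] (S : Subgroup G) :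
    Prop where
  isClosed : IsClosed (S : Set G)
  isProP : IsProP p S
  not_dvd_index : ∀ N : Subgroup G, N.Normal → IsOpen (N : Set G) → ¬ p ∣ (S ⊔ N).index

section Fusion

open CategoryTheory

variable {G : Type*} [Group G] [TopologicalSpace G]

/-- The objects of the pro-fusion system `F_S(G)`: the closed subgroups of `S`. -/
structure ProFusion (S : Subgroup G) where
  /-- The underlying closed subgroup of `S`. -/
  grp : ClosedSubgroup S

namespace ProFusion

variable {S : Subgroup G}

/-- The morphisms `P → Q` of `F_S(G)`: the continuous homomorphisms of the form `x ↦ g x g⁻¹` for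
some `g ∈ G`. -/
def Hom (P Q : ProFusion S) : Type _ :=
  {φ : P.grp →ₜ* Q.grp // ∃ g : G, ∀ x : P.grp, ((φ x : S) : G) = g * ((x : S) : G) * g⁻¹}

/-- The pro-fusion system `F_S(G)`, as a category. -/
instance : Category (ProFusion S) where
  Hom := Hom
  id P := ⟨ContinuousMonoidHom.id _, 1, fun x => by simp⟩
  comp φ ψ := ⟨ψ.1.comp φ.1, by
    obtain ⟨g, hg⟩ := φ.2
    obtain ⟨h, hh⟩ := ψ.2
    refine ⟨h * g, fun x => ?_⟩
    rw [ContinuousMonoidHom.comp_toFun, hh, hg]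
    group⟩

variable (S) in
/-- The object `S` of `F_S(G)`. -/
def top : ProFusion S := ⟨⟨⊤, isClosed_univ⟩⟩

/-- The inclusion homomorphism `P → S`. -/
def incl (P : ProFusion S) : P.grp →ₜ* S := P.grp.toSubgroup.contSubtype

/-- A morphism `P → S` of `F_S(G)`, as a homomorphism into `S`. -/
def toS {P : ProFusion S} (φ : P ⟶ top S) : P.grp →ₜ* S := (top S).incl.comp φ.1

/-- The ring of elements `x ∈ H^*_c(S; 𝔽_p)` with `φ^* x = res^S_P x` for all objects `P` in the
class `𝒪` and all morphisms `φ : P → S` of `F_S(G)`. -/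
def stableOn (p : ℕ) (S : Subgroup G) (𝒪 : Set (ProFusion S)) : Subring (ContCoh.H p S) where
  carrier := {x | ∀ P ∈ 𝒪, ∀ φ : P ⟶ top S,
    ContCoh.HMap p (toS φ) x = ContCoh.HMap p P.incl x}
  mul_mem' hx hy P hP φ := by rw [map_mul, map_mul, hx P hP φ, hy P hP φ]
  one_mem' P _ φ := by rw [map_one, map_one]
  add_mem' hx hy P hP φ := by rw [map_add, map_add, hx P hP φ, hy P hP φ]
  zero_mem' P _ φ := by rw [map_zero, map_zero]
  neg_mem' hx P hP φ := by rw [map_neg, map_neg, hx P hP φ]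

/-- The ring `H^*_c(S; 𝔽_p)^{F_S(G)}` of `F_S(G)`-stable elements. -/
def stable (p : ℕ) (S : Subgroup G) : Subring (ContCoh.H p S) :=
  stableOn p S Set.univ

/-- The ring `H^*_c(S; 𝔽_p)^{F_S(G)°}` of `F_S(G)°`-stable elements, where `F_S(G)°` is the full
subcategory of `F_S(G)` on the open subgroups of `S`. -/
def stableOpen (p : ℕ) (S : Subgroup G) : Subring (ContCoh.H p S) :=
  stableOn p S {P | IsOpen (P.grp : Set S)}

end ProFusion

end Fusion

/-! ## Cochains on sequences -/

namespace ContCoh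

section Relative

set_option linter.unusedSectionVars false

variable {p : ℕ} {G : Type*} [Group G] [TopologicalSpace G]

/-! The cohomology of every closed subgroup `A` of `G` can be computed inside one space, that of
functions of sequences in `G`. An `A`-invariant cochain on `G` restricts to a cochain on `A`; a map
`G → A` that is equivariant modulo an open normal subgroup (`exists_retraction`), together with the
prism homotopy (`sub_comp_mem_relBd`), leads back. Restriction to a smaller subgroup becomes an
inclusion, and conjugation becomes translation.

By compactness a cocycle on `S` extends to a cocycle `F` invariant under `U = S N`, with `N` open
normal (`exists_extension`). The index of `U` is finite and prime to `p`, so the translates of `F`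
over `G ⧸ U` can be averaged to a `G`-invariant cocycle. No double coset formula is needed to
restrict the average to `S`: the differences of `F` from its translates form an `S`-equivariant
family indexed by `G ⧸ U`. A Sylow argument (`exists_mk_eq_conj_mem`) gives each coset a
representative conjugating its stabilizer in `S` into `S`. The stabilizer is open in `S`, so
stability on open subgroups makes the difference a coboundary there, and `sum_mem_relBd` assembles
these into a coboundary for `S`. Thus stable elements on open subgroups are restrictions.

Restrictions are stable because inner automorphisms act trivially on cohomology (`HMap_eq_of_conj`),
and stable elements are stable on open subgroups, so the three subrings coincide. Injectivity
follows by averaging an `S`-invariant primitive in the same way (`mem_coboundaries_of_restrict`). -/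

variable (p) in
/-- Continuous `n`-cochains on `G` invariant under a subgroup `A`, as functions of sequences: they
depend on the first `n + 1` terms only, modulo an open normal subgroup of `G`. -/
def RelCochain (A : Subgroup G) (n : ℕ) : Submodule (ZMod p) ((ℕ → G) → ZMod p) where
  carrier := {f | (∀ a ∈ A, ∀ y, f (fun i => a * y i) = f y) ∧
    ∃ N : OpenNormalSubgroup G, ∀ y z : ℕ → G, (∀ i ≤ n, (y i)⁻¹ * z i ∈ N) → f y = f z}
  add_mem' := by
    rintro f h ⟨hf, N, hN⟩ ⟨hh, M, hM⟩
    refine ⟨fun a ha y => by simp [hf a ha y, hh a ha y], N ⊓ M, fun y z w => ?_⟩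
    exact congrArg₂ (· + ·) (hN y z fun i hi => (w i hi).1) (hM y z fun i hi => (w i hi).2)
  zero_mem' := ⟨fun _ _ _ => rfl, ⟨⟨⊤, isOpen_univ⟩, inferInstanceAs (⊤ : Subgroup G).Normal⟩,
    fun _ _ _ => rfl⟩
  smul_mem' := by
    rintro c f ⟨hf, N, hN⟩
    exact ⟨fun a ha y => by simp [hf a ha y], N, fun y z w => by simp [hN y z w]⟩

theorem RelCochain.anti {A B : Subgroup G} (h : A ≤ B) (n : ℕ) :
    RelCochain p B n ≤ RelCochain p A n :=
  fun _ hf => ⟨fun a ha => hf.1 a (h ha), hf.2⟩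

/-- The coboundary of a cochain on sequences. -/
def seqD (n : ℕ) : ((ℕ → G) → ZMod p) →ₗ[ZMod p] ((ℕ → G) → ZMod p) where
  toFun f y := ∑ i ∈ Finset.range (n + 2), (-1) ^ i * f (face i y)
  map_add' f h := by
    ext y
    simp [mul_add, Finset.sum_add_distrib]
  map_smul' c f := by
    ext y
    simp [Finset.mul_sum, mul_left_comm]

theorem seqD_apply (n : ℕ) (f : (ℕ → G) → ZMod p) (y : ℕ → G) :
    seqD n f y = ∑ i ∈ Finset.range (n + 2), (-1) ^ i * f (face i y) := rfl

theorem face_comp {K : Type*} (r : K → G) (i : ℕ) (y : ℕ → K) :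
    face i (fun j => r (y j)) = fun j => r (face i y j) := by
  funext j
  unfold face
  split_ifs <;> rfl

theorem seqD_comp (n : ℕ) (f : (ℕ → G) → ZMod p) (r : G → G) (y : ℕ → G) :
    seqD n (fun y => f (fun i => r (y i))) y = seqD n f (fun i => r (y i)) := by
  simp only [seqD_apply, face_comp]

theorem seqD_zero_eq {f : (ℕ → G) → ZMod p} (hf : seqD 0 f = 0) (y : ℕ → G) :
    f (fun i => y (i + 1)) = f (face 1 y) := by
  have h := congrFun hf y
  simp only [seqD_apply, Finset.sum_range_succ, Finset.sum_range_zero, Pi.zero_apply] at h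
  have e : face 0 y = fun i => y (i + 1) := by
    funext i
    simp [face]
  rw [e] at h
  linear_combination h

variable (p) in
/-- Coboundaries of `A`-invariant cochains. -/
def RelBd (A : Subgroup G) : ℕ → Submodule (ZMod p) ((ℕ → G) → ZMod p)
  | 0 => ⊥
  | n + 1 => (RelCochain p A n).map (seqD n)

/-! ### The prism operator -/

/-- The simplex `(y₀, …, yᵢ, r yᵢ, r yᵢ₊₁, …)`. -/
def prismSeq (r : G → G) (i : ℕ) (y : ℕ → G) : ℕ → G :=
  fun j => if j ≤ i then y j else r (y (j - 1))

/-- The prism operator, a homotopy between `f` and `f ∘ r`. -/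
def prism (r : G → G) (n : ℕ) (f : (ℕ → G) → ZMod p) : (ℕ → G) → ZMod p :=
  fun y => ∑ i ∈ Finset.range (n + 1), (-1) ^ i * f (prismSeq r i y)

/-- Sign bookkeeping for the prism: off the two diagonals, a face of a prism simplex is a prism
simplex over a face of the base; the diagonal faces, shared by neighbouring simplices, telescope in
`c`. -/
theorem prism_sum {R : Type*} [CommRing R] (n : ℕ) (a b : ℕ → ℕ → R) (c : ℕ → R)
    (h1 : ∀ i j, j < i + 1 → a (i + 1) j = b j i) (h2 : ∀ i j, i < j → a i (j + 1) = b j i)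
    (h3 : ∀ i, a i i = c i) (h4 : ∀ i, a i (i + 1) = c (i + 1)) :
    ∑ i ∈ Finset.range (n + 2), (-1) ^ i * ∑ j ∈ Finset.range (n + 3), (-1) ^ j * a i j =
      c 0 - c (n + 2) - ∑ j ∈ Finset.range (n + 2), (-1) ^ j *
        ∑ i ∈ Finset.range (n + 1), (-1) ^ i * b j i := by
  -- Each inner sum is cut at `j = i` and `j = i + 1`, the two faces that telescope.
  have key : ∀ i ∈ Finset.range (n + 2), (-1) ^ i * ∑ j ∈ Finset.range (n + 3), (-1) ^ j * a i j =
      (c i - c (i + 1)) + (-1) ^ i * (∑ j ∈ Finset.range i, (-1) ^ j * a i j) -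
      (-1) ^ i * ∑ j ∈ Finset.Ico (i + 1) (n + 2), (-1) ^ j * b j i := by
    intro i hi
    rw [Finset.mem_range] at hi
    have hs : ((-1 : R) ^ i) * (-1) ^ i = 1 := by
      rw [← mul_pow]
      simp
    rw [← Finset.sum_range_add_sum_Ico _ (show i + 2 ≤ n + 3 by omega), Finset.sum_range_succ,
      Finset.sum_range_succ, h3, h4, show i + 2 = (i + 1) + 1 from rfl,
      ← Finset.sum_Ico_add' _ (i + 1) (n + 2) 1]
    have : ∑ j ∈ Finset.Ico (i + 1) (n + 2), (-1) ^ (j + 1) * a i (j + 1) =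
        - ∑ j ∈ Finset.Ico (i + 1) (n + 2), (-1) ^ j * b j i := by
      rw [← Finset.sum_neg_distrib]
      refine Finset.sum_congr rfl fun j hj => ?_
      rw [h2 i j (by have := (Finset.mem_Ico.mp hj).1; omega)]
      ring
    rw [this]
    linear_combination (c i - c (i + 1)) * hs
  rw [Finset.sum_congr rfl key, Finset.sum_sub_distrib, Finset.sum_add_distrib,
    Finset.sum_range_sub', Finset.sum_range_succ' (fun i => (-1 : R) ^ i *
      ∑ j ∈ Finset.range i, (-1) ^ j * a i j),
    Finset.sum_range_succ (fun i => (-1 : R) ^ i *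
      ∑ j ∈ Finset.Ico (i + 1) (n + 2), (-1) ^ j * b j i)]
  simp only [Finset.range_zero, Finset.sum_empty, Finset.Ico_self, mul_zero, add_zero]
  have e : ∑ j ∈ Finset.range (n + 2), (-1) ^ j * ∑ i ∈ Finset.range (n + 1), (-1) ^ i * b j i =
      ∑ i ∈ Finset.range (n + 1), (-1) ^ i * ∑ j ∈ Finset.range (n + 2), (-1) ^ j * b j i := by
    simp only [Finset.mul_sum]
    rw [Finset.sum_comm]
    exact Finset.sum_congr rfl fun _ _ => Finset.sum_congr rfl fun _ _ => by ring
  have e2 : ∑ i ∈ Finset.range (n + 1), (-1 : R) ^ (i + 1) *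
      ∑ j ∈ Finset.range (i + 1), (-1) ^ j * a (i + 1) j =
      - ∑ i ∈ Finset.range (n + 1), (-1 : R) ^ i * ∑ j ∈ Finset.range (i + 1), (-1) ^ j * b j i := by
    rw [← Finset.sum_neg_distrib]
    refine Finset.sum_congr rfl fun i _ => ?_
    rw [Finset.sum_congr rfl fun j hj => by rw [h1 i j (Finset.mem_range.mp hj)]]
    ring
  have e3 : ∑ i ∈ Finset.range (n + 1), (-1 : R) ^ i *
      ∑ j ∈ Finset.range (n + 2), (-1) ^ j * b j i =
      ∑ i ∈ Finset.range (n + 1), (-1 : R) ^ i * ∑ j ∈ Finset.range (i + 1), (-1) ^ j * b j i +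
      ∑ i ∈ Finset.range (n + 1), (-1 : R) ^ i *
        ∑ j ∈ Finset.Ico (i + 1) (n + 2), (-1) ^ j * b j i := by
    rw [← Finset.sum_add_distrib]
    refine Finset.sum_congr rfl fun i hi => ?_
    rw [← mul_add, Finset.sum_range_add_sum_Ico _ (by
      have := Finset.mem_range.mp hi
      omega)]
  rw [e, e2, e3]
  ring

/-- The homotopy formula; its second term, the prism of the coboundary of `f`, vanishes by `hd`.
Locality `hf` is needed because the bottom end agrees with `y` only in its first `n + 2` entries. -/
theorem seqD_prism (r : G → G) {n : ℕ} {f : (ℕ → G) → ZMod p}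
    (hf : ∀ y z : ℕ → G, (∀ i ≤ n + 1, y i = z i) → f y = f z) (hd : seqD (n + 1) f = 0) :
    seqD n (prism r n f) = (fun y => f (fun i => r (y i))) - f := by
  funext y
  have h := prism_sum n (fun i j => f (face j (prismSeq r i y)))
    (fun j i => f (prismSeq r i (face j y)))
    (fun i => f (fun j => if j < i then y j else r (y j))) ?_ ?_ ?_ ?_
  · have h0 : ∀ i, ∑ j ∈ Finset.range (n + 3), (-1) ^ j * f (face j (prismSeq r i y)) = 0 :=
      fun i => congrFun hd (prismSeq r i y)
    simp only [h0, mul_zero, Finset.sum_const_zero] at h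
    have h1 : f (fun j => if j < n + 2 then y j else r (y j)) = f y :=
      hf _ _ fun i hi => if_pos (by omega)
    rw [h1] at h
    simp only [not_lt_zero, if_false] at h
    change ∑ j ∈ Finset.range (n + 2), (-1) ^ j * ∑ i ∈ Finset.range (n + 1), (-1) ^ i *
      f (prismSeq r i (face j y)) = f (fun i => r (y i)) - f y
    linear_combination h
  all_goals intro i
  · intro j hj
    refine congrArg f (funext fun l => ?_)
    simp only [face, prismSeq]
    split_ifs <;> first | rfl | omega | exact congrArg r (congrArg y (by omega))
  · intro j hj
    refine congrArg f (funext fun l => ?_)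
    simp only [face, prismSeq]
    split_ifs <;> first | rfl | omega | exact congrArg r (congrArg y (by omega))
  all_goals
    refine congrArg f (funext fun l => ?_)
    simp only [face, prismSeq]
    split_ifs <;> first | rfl | omega

/-- `f` and `f ∘ r` are cohomologous if `r` is `A`-equivariant modulo an open normal subgroup under
which `f` is invariant. -/
theorem sub_comp_mem_relBd {A : Subgroup G} {n : ℕ} {f : (ℕ → G) → ZMod p}
    (hA : ∀ a ∈ A, ∀ y, f (fun i => a * y i) = f y) (N : OpenNormalSubgroup G)
    (hN : ∀ y z : ℕ → G, (∀ i ≤ n, (y i)⁻¹ * z i ∈ N) → f y = f z) (hd : seqD n f = 0) (r : G → G)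
    (h1 : ∀ x y, x⁻¹ * y ∈ N → (r x)⁻¹ * r y ∈ N) (h2 : ∀ a ∈ A, ∀ x, (a * r x)⁻¹ * r (a * x) ∈ N) :
    f - (fun y => f (fun i => r (y i))) ∈ RelBd p A n := by
  cases n with
  | zero =>
    refine (Submodule.mem_bot _).mpr (funext fun y => sub_eq_zero.mpr ?_)
    -- There are no cochains in degree `-1`, so equality must be literal: the cocycle identity is
    -- applied to the edge from `r (y 0)` to `y 0`.
    have h := seqD_zero_eq hd (fun i => if i = 0 then r (y 0) else y (i - 1))
    refine Eq.trans ?_ (h.trans ?_)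
    · simp
    · refine hN _ _ fun i hi => ?_
      obtain rfl : i = 0 := by omega
      simp [face, one_mem]
  | succ n =>
    rw [← neg_sub, ← seqD_prism r (fun y z w => hN y z fun i hi => by simp [w i hi, one_mem]) hd]
    refine Submodule.neg_mem _ (Submodule.mem_map_of_mem ⟨fun a ha y => ?_, N, fun y z w => ?_⟩)
    · refine Finset.sum_congr rfl fun i _ => congrArg _ ?_
      rw [← hA a ha (prismSeq r i y)]
      refine hN _ _ fun j _ => ?_
      unfold prismSeq
      split_ifs
      · simp [one_mem]
      · have := inv_mem (h2 a ha (y (j - 1)))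
        simpa [mul_assoc] using this
    · refine Finset.sum_congr rfl fun i hi => congrArg _ ?_
      rw [Finset.mem_range] at hi
      refine hN _ _ fun j hj => ?_
      unfold prismSeq
      split_ifs
      · exact w j (by omega)
      · exact h1 _ _ (w (j - 1) (by omega))

end Relative

end ContCoh

/-! ### Comparison of cochains on sequences with cochains on a group -/

namespace ContCoh

section Restriction

set_option linter.unusedSectionVars false

variable {p : ℕ} {G K : Type*} [Group G] [TopologicalSpace G] [IsTopologicalGroup G]
  [Group K] [TopologicalSpace K]

/-- The pullback of a cochain on sequences along a homomorphism with image in `A`. -/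
def pullback (ψ : K →ₜ* G) {A : Subgroup G} (hψ : ∀ k, ψ k ∈ A) {n : ℕ} {f : (ℕ → G) → ZMod p}
    (hf : f ∈ RelCochain p A n) : Cochain p K n :=
  ⟨fun x => f (fun i => ψ (x (Fin.ofNat (n + 1) i))), by
    obtain ⟨N, hN⟩ := hf.2
    refine IsLocallyConstant.continuous ((IsLocallyConstant.iff_eventually_eq _).mpr fun x => ?_)
    have h : ∀ i : Fin (n + 1), ∀ᶠ z : Fin (n + 1) → K in nhds x, (ψ (x i))⁻¹ * ψ (z i) ∈ N := by
      intro i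
      have hc : Continuous fun z : Fin (n + 1) → K => (ψ (x i))⁻¹ * ψ (z i) :=
        continuous_const.mul (ψ.continuous_toFun.comp (continuous_apply i))
      refine hc.continuousAt.eventually (N.isOpen'.mem_nhds ?_)
      simp
    filter_upwards [Filter.eventually_all.mpr h] with z hz
    exact (hN _ _ fun i _ => hz _).symm,
  fun g x => by simpa only [map_mul] using hf.1 (ψ g) (hψ g) _⟩

theorem ev_pullback (ψ : K →ₜ* G) {A : Subgroup G} (hψ : ∀ k, ψ k ∈ A) {n : ℕ}
    {f : (ℕ → G) → ZMod p} (hf : f ∈ RelCochain p A n) (y : ℕ → K) :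
    ev (pullback ψ hψ hf) y = f (fun i => ψ (y i)) := by
  obtain ⟨N, hN⟩ := hf.2
  refine hN _ _ fun i hi => ?_
  simp [Nat.mod_eq_of_lt (show i < n + 1 by omega)]

theorem ev_d_eq_seqD (ψ : K →ₜ* G) {n : ℕ} {c : Cochain p K n} {f : (ℕ → G) → ZMod p}
    (h : ∀ y, ev c y = f (fun i => ψ (y i))) (y : ℕ → K) :
    ev (d n c) y = seqD n f (fun i => ψ (y i)) := by
  simp only [ev_d, seqD_apply, h, face_comp]

theorem mem_coboundaries_of_relBd (ψ : K →ₜ* G) {A : Subgroup G} (hψ : ∀ k, ψ k ∈ A) {n : ℕ}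
    {c : Cochain p K n} {f : (ℕ → G) → ZMod p} (hf : f ∈ RelBd p A n)
    (h : ∀ y, ev c y = f (fun i => ψ (y i))) : c ∈ coboundaries p K n := by
  cases n with
  | zero =>
    refine (Submodule.mem_bot _).mpr (cochain_ext fun y => ?_)
    rw [h, (Submodule.mem_bot _).mp hf]
    rfl
  | succ n =>
    obtain ⟨k, hk, rfl⟩ := hf
    refine ⟨pullback ψ hψ hk, cochain_ext fun y => ?_⟩
    rw [h, ev_d_eq_seqD ψ (ev_pullback ψ hψ hk)]

end Restriction

/-- A subgroup of a group admits an equivariant retraction modulo a normal subgroup. -/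
theorem exists_retraction {G K : Type*} [Group G] [Group K] (ψ : K →* G) (N : Subgroup G) [N.Normal] : ∃ r : G → K,
    (∀ x y, x⁻¹ * y ∈ N → r x = r y) ∧
    (∀ k x, (ψ k * ψ (r x))⁻¹ * ψ (r (ψ k * x)) ∈ N) ∧ ∀ k, (ψ k)⁻¹ * ψ (r (ψ k)) ∈ N := by
  let rel : Setoid (G ⧸ N) :=
    { r := fun a b => ∃ k : K, ((ψ k : G) : G ⧸ N) * b = a
      iseqv := ⟨fun a => ⟨1, by simp⟩, fun {a b} ⟨k, hk⟩ => ⟨k⁻¹, by rw [← hk]; simp⟩,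
        fun {a b c} ⟨k, hk⟩ ⟨l, hl⟩ => ⟨k * l, by rw [← hk, ← hl]; simp [mul_assoc]⟩⟩ }
  have hout : ∀ a : G ⧸ N, ∃ k : K, ((ψ k : G) : G ⧸ N) * (Quotient.mk rel a).out = a :=
    fun a => rel.symm (Quotient.mk_out (s := rel) a)
  choose σ hσ using hout
  have hinv : ∀ k a, Quotient.mk rel (((ψ k : G) : G ⧸ N) * a) = Quotient.mk rel a :=
    fun k a => Quotient.sound ⟨k, rfl⟩
  -- `σ` is a choice, but left translation on `G ⧸ N` is free: cancelling the orbit representative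
  -- shows that `σ` is equivariant modulo `N`.
  have hmul : ∀ k a, ((ψ (σ (((ψ k : G) : G ⧸ N) * a)) : G) : G ⧸ N) = (ψ k : G) * (ψ (σ a) : G) := by
    intro k a
    have h := hσ (((ψ k : G) : G ⧸ N) * a)
    rw [hinv] at h
    refine mul_right_cancel (h.trans ?_)
    rw [mul_assoc, hσ]
  -- The factor `(σ 1)⁻¹` normalizes the map so that it fixes the image of `ψ` modulo `N`; right
  -- multiplication does not disturb equivariance.
  refine ⟨fun x => σ x * (σ 1)⁻¹, fun x y h => ?_, fun k x => ?_, fun k => ?_⟩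
  · exact congrArg (fun a => σ a * (σ 1)⁻¹) (QuotientGroup.eq.mpr h)
  · rw [← QuotientGroup.eq]
    have := hmul k x
    simp only [QuotientGroup.mk_mul, map_mul, map_inv, QuotientGroup.mk_inv, this, mul_assoc]
  · rw [← QuotientGroup.eq]
    have := hmul k 1
    rw [mul_one] at this
    simp only [QuotientGroup.mk_mul, map_mul, map_inv, QuotientGroup.mk_inv, this,
      mul_inv_cancel_right]

/-! ### Coboundaries on closed subgroups of a profinite group -/

section Profinite

set_option linter.unusedSectionVars false

variable {p : ℕ} {G K : Type*} [Group G] [TopologicalSpace G] [IsTopologicalGroup G]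
  [CompactSpace G] [TotallyDisconnectedSpace G] [Group K] [TopologicalSpace K]
  [IsTopologicalGroup K] [CompactSpace K]

/-- A continuous cochain on a closed subgroup is invariant under an open normal subgroup of the
ambient profinite group. -/
theorem exists_openNormal_invariant (ψ : K →ₜ* G) (hψ : Function.Injective ψ) {n : ℕ}
    (c : Cochain p K n) : ∃ N : OpenNormalSubgroup G,
      ∀ y z : ℕ → K, (∀ i ≤ n, (ψ (y i))⁻¹ * ψ (z i) ∈ N) → ev c y = ev c z := by
  have hemb : Topology.IsEmbedding ψ :=
    (Continuous.isClosedEmbedding ψ.continuous_toFun hψ).isEmbedding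
  -- Uniform continuity, from compactness of `K ^ (n + 1)` and discreteness of the coefficients.
  have h1 : ∀ᶠ v : Fin (n + 1) → K in nhds 1, ∀ x ∈ (Set.univ : Set (Fin (n + 1) → K)),
      c.1 (x * v) = c.1 x := by
    refine isCompact_univ.eventually_forall_of_forall_eventually fun x _ => ?_
    have hc : Continuous fun q : (Fin (n + 1) → K) × (Fin (n + 1) → K) =>
        c.1 (q.2 * q.1) - c.1 q.2 :=
      (c.2.1.comp (continuous_snd.mul continuous_fst)).sub (c.2.1.comp continuous_snd)
    have := (hc.continuousAt (x := (1, x))).eventually ((isOpen_discrete {(0 : ZMod p)}).mem_nhds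
      (by simp))
    filter_upwards [this] with q hq
    exact sub_eq_zero.mp hq
  rw [nhds_pi, Filter.Eventually, Filter.mem_pi'] at h1
  obtain ⟨I, t, ht, hI⟩ := h1
  have h2 : (⋂ i, t i) ∈ nhds (1 : K) := Filter.iInter_mem.mpr ht
  rw [hemb.nhds_eq_comap, map_one] at h2
  obtain ⟨W, hW, hWt⟩ := h2
  obtain ⟨W', hW', hWo, h1W⟩ := mem_nhds_iff.mp hW
  obtain ⟨N, hN⟩ := ProfiniteGrp.exist_openNormalSubgroup_sub_open_nhds_of_one hWo h1W
  refine ⟨N, fun y z w => ?_⟩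
  have := @hI (fun i : Fin (n + 1) => (y i)⁻¹ * z i) (fun i _ => ?_) (fun i => y i) trivial
  · refine this.symm.trans (congrArg c.1 (funext fun i => ?_))
    simp
  · refine Set.mem_iInter.mp (hWt (hW' (hN ?_))) i
    simpa using w i (by omega)

/-- A relative cocycle is a relative coboundary as soon as its restriction is a coboundary. -/
theorem mem_relBd_of_coboundaries (ψ : K →ₜ* G) (hψ : Function.Injective ψ) {n : ℕ}
    {f : (ℕ → G) → ZMod p} (hf : f ∈ RelCochain p ψ.toMonoidHom.range n) (hd : seqD n f = 0)
    {c : Cochain p K n} (hc : c ∈ coboundaries p K n) (h : ∀ y, ev c y = f (fun i => ψ (y i))) :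
    f ∈ RelBd p ψ.toMonoidHom.range n := by
  obtain ⟨N, hN⟩ := hf.2
  have key : ∀ (M : OpenNormalSubgroup G), M ≤ N → ∀ r : G → K,
      (∀ x y, x⁻¹ * y ∈ M → r x = r y) → (∀ k x, (ψ k * ψ (r x))⁻¹ * ψ (r (ψ k * x)) ∈ M) →
      f - (fun y => f (fun i => ψ (r (y i)))) ∈ RelBd p ψ.toMonoidHom.range n := by
    intro M hM r h1 h2
    refine sub_comp_mem_relBd hf.1 M (fun y z w => hN y z fun i hi => hM (w i hi)) hd
      (fun x => ψ (r x)) (fun x y hxy => ?_) ?_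
    · simp [h1 x y hxy]
    · rintro _ ⟨k, rfl⟩ x
      exact h2 k x
  cases n with
  | zero =>
    obtain ⟨r, h1, h2, -⟩ := exists_retraction ψ.toMonoidHom N.toSubgroup
    convert key N le_rfl r h1 h2 using 1
    rw [eq_comm, sub_eq_self]
    funext y
    rw [← h (fun i => r (y i)), (Submodule.mem_bot _).mp hc]
    rfl
  | succ n =>
    obtain ⟨a, rfl⟩ := hc
    obtain ⟨M, hM⟩ := exists_openNormal_invariant ψ hψ a
    -- Equivariance modulo `N` serves the homotopy for `f`; modulo `M` it makes the transported
    -- primitive `a ∘ r` exactly invariant.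
    obtain ⟨r, h1, h2, -⟩ := exists_retraction ψ.toMonoidHom (N ⊓ M : OpenNormalSubgroup G).toSubgroup
    rw [← sub_add_cancel f (fun y => f (fun i => ψ (r (y i))))]
    refine Submodule.add_mem _ (key (N ⊓ M) inf_le_left r h1 h2)
      ⟨fun y => ev a (fun i => r (y i)), ⟨?_, N ⊓ M, fun y z w => ?_⟩, funext fun y => ?_⟩
    · rintro _ ⟨k, rfl⟩ y
      refine (hM _ (fun i => k * r (y i)) fun i _ => ?_).trans (a.2.2 k fun i => r (y i))
      have h3 : (ψ k * ψ (r (y i)))⁻¹ * ψ (r (ψ k * y i)) ∈ M := (h2 k (y i)).2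
      have := inv_mem h3
      simpa [mul_assoc] using this
    · refine ev_congr a fun i hi => h1 _ _ (w i (by omega))
    · rw [← h (fun i => r (y i)), ev_d, seqD_apply]
      simp only [face_comp]

end Profinite

end ContCoh

namespace ContCoh

/-! ### Translates and transfer -/

section Transfer

set_option linter.unusedSectionVars false

variable {p : ℕ} {G : Type*} [Group G] [TopologicalSpace G]

theorem translate_mem {A B : Subgroup G} {n : ℕ} {f : (ℕ → G) → ZMod p}
    (hf : f ∈ RelCochain p A n) (g : G) (h : ∀ b ∈ B, g⁻¹ * b * g ∈ A) :
    (fun y => f (fun i => g⁻¹ * y i)) ∈ RelCochain p B n := by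
  obtain ⟨hA, N, hN⟩ := hf
  refine ⟨fun b hb y => ?_, N, fun y z w => hN _ _ fun i hi => ?_⟩
  · refine Eq.trans (congrArg f (funext fun i => ?_)) (hA _ (h b hb) _)
    group
  · simpa [mul_assoc] using w i hi

theorem translate_right_mem {A : Subgroup G} {n : ℕ} {f : (ℕ → G) → ZMod p}
    (hf : f ∈ RelCochain p A n) (g : G) : (fun y => f (fun i => y i * g)) ∈ RelCochain p A n := by
  obtain ⟨hA, N, hN⟩ := hf
  refine ⟨fun b hb y => ?_, N, fun y z w => hN _ _ fun i hi => ?_⟩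
  · refine Eq.trans (congrArg f (funext fun i => ?_)) (hA b hb _)
    group
  · have := N.isNormal'.conj_mem _ (w i hi) g⁻¹
    have e : g⁻¹ * ((y i)⁻¹ * z i) * g⁻¹⁻¹ = (y i * g)⁻¹ * (z i * g) := by group
    rwa [e] at this

/-- Right translation commutes with the left action, so it is an admissible `r` for the prism. This
is the cochain form of the triviality of inner automorphisms on cohomology. -/
theorem sub_translate_right_mem_relBd {A : Subgroup G} {n : ℕ} {f : (ℕ → G) → ZMod p}
    (hf : f ∈ RelCochain p A n) (hd : seqD n f = 0) (g : G) :
    f - (fun y => f (fun i => y i * g)) ∈ RelBd p A n := by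
  obtain ⟨hA, N, hN⟩ := hf
  refine sub_comp_mem_relBd hA N hN hd (fun x => x * g) (fun x y h => ?_) fun a _ x => ?_
  · have := N.isNormal'.conj_mem _ h g⁻¹
    have e : g⁻¹ * (x⁻¹ * y) * g⁻¹⁻¹ = (x * g)⁻¹ * (y * g) := by group
    rwa [e] at this
  · simp [mul_assoc]

/-- Left multiplication of an entry by an element of `N` is right multiplication by a conjugate,
again in `N`, which `f` does not see. Enlarging `A` to an open subgroup makes the transfer a finite
sum when `G` is compact. -/
theorem mem_relCochain_sup {A : Subgroup G} {n : ℕ} {f : (ℕ → G) → ZMod p}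
    (hA : ∀ a ∈ A, ∀ y, f (fun i => a * y i) = f y) (N : OpenNormalSubgroup G)
    (hN : ∀ y z : ℕ → G, (∀ i ≤ n, (y i)⁻¹ * z i ∈ N) → f y = f z) :
    f ∈ RelCochain p (A ⊔ N.toSubgroup) n := by
  refine ⟨fun a ha y => ?_, N, hN⟩
  obtain ⟨b, hb, m, hm, rfl⟩ := Subgroup.mem_sup_of_normal_right.mp ha
  simp only [mul_assoc]
  rw [hA b hb]
  refine (hN _ _ fun i _ => ?_).symm
  have := N.isNormal'.conj_mem _ hm (y i)⁻¹
  have e : (y i)⁻¹ * m * (y i)⁻¹⁻¹ = (y i)⁻¹ * (m * y i) := by group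
  rw [e] at this
  simpa using (show _ ∈ N from this)

theorem seqD_translate (n : ℕ) (f : (ℕ → G) → ZMod p) (g : G) :
    seqD n (fun y => f (fun i => g * y i)) = fun y => seqD n f (fun i => g * y i) :=
  funext fun y => seqD_comp n f (fun x => g * x) y

/-- The translate of a `U`-invariant cochain indexed by a coset of `U`. -/
noncomputable def cosetTranslate {U : Subgroup G} (f : (ℕ → G) → ZMod p) (q : G ⧸ U) :
    (ℕ → G) → ZMod p :=
  fun y => f (fun i => q.out⁻¹ * y i)

/-- Invariance under `U` frees the translate from the representative `q.out`, so that one adapted to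
a stabilizer can be used instead. -/
theorem cosetTranslate_mk {U : Subgroup G} {f : (ℕ → G) → ZMod p}
    (hf : ∀ a ∈ U, ∀ y, f (fun i => a * y i) = f y) (g : G) (y : ℕ → G) :
    cosetTranslate f (g : G ⧸ U) y = f (fun i => g⁻¹ * y i) := by
  obtain ⟨u, hu⟩ := QuotientGroup.mk_out_eq_mul U g
  unfold cosetTranslate
  rw [hu, ← hf u u.2]
  simp [mul_assoc]

theorem cosetTranslate_smul {U : Subgroup G} {f : (ℕ → G) → ZMod p}
    (hf : ∀ a ∈ U, ∀ y, f (fun i => a * y i) = f y) (g : G) (q : G ⧸ U) (y : ℕ → G) :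
    cosetTranslate f (g • q) (fun i => g * y i) = cosetTranslate f q y := by
  obtain ⟨x, rfl⟩ := QuotientGroup.mk_surjective q
  rw [MulAction.Quotient.smul_mk, cosetTranslate_mk hf, cosetTranslate_mk hf]
  simp [mul_assoc]

theorem sum_cosetTranslate_mem {U : Subgroup G} [Fintype (G ⧸ U)] {n : ℕ} {f : (ℕ → G) → ZMod p}
    (hf : f ∈ RelCochain p U n) : ∑ q : G ⧸ U, cosetTranslate f q ∈ RelCochain p ⊤ n := by
  refine ⟨fun a _ y => ?_, ?_⟩
  · rw [Finset.sum_apply, Finset.sum_apply]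
    refine (Fintype.sum_equiv (MulAction.toPerm a) _ _ fun q => ?_).symm
    exact (cosetTranslate_smul hf.1 a q y).symm
  · refine (Submodule.sum_mem (RelCochain p (⊥ : Subgroup G) n) fun q _ => ?_).2
    exact translate_mem hf _ fun b hb => by simp [Subgroup.mem_bot.mp hb, one_mem]

theorem seqD_sum_cosetTranslate {U : Subgroup G} [Fintype (G ⧸ U)] (n : ℕ)
    (f : (ℕ → G) → ZMod p) : seqD n (∑ q : G ⧸ U, cosetTranslate f q) =
      ∑ q : G ⧸ U, cosetTranslate (seqD n f) q := by
  rw [map_sum]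
  exact Finset.sum_congr rfl fun q _ => seqD_translate n f _

/-- An equivariant family of cochains, each a coboundary for the stabilizer of its index, has a
coboundary as its sum. -/
theorem sum_mem_relBd {S : Subgroup G} {X : Type*} [Fintype X] [MulAction S X] {n : ℕ}
    (f : X → (ℕ → G) → ZMod p) (hf : ∀ (s : S) x y, f (s • x) (fun i => s * y i) = f x y)
    (hB : ∀ x, f x ∈ RelBd p ((MulAction.stabilizer S x).map S.subtype) n) :
    ∑ x, f x ∈ RelBd p S n := by
  cases n with
  | zero => exact Submodule.sum_mem _ fun x _ => hB x
  | succ n =>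
    choose k hk hkf using hB
    have ho : ∀ x : X, ∃ s : S, s • (Quotient.mk (MulAction.orbitRel S X) x).out = x :=
      fun x => (MulAction.orbitRel S X).symm (Quotient.mk_out (s := MulAction.orbitRel S X) x)
    choose σ hσ using ho
    let o : X → X := fun x => (Quotient.mk (MulAction.orbitRel S X) x).out
    have hoσ : ∀ x, σ x • o x = x := hσ
    have hos : ∀ (s : S) x, o (s • x) = o x := fun s x =>
      congrArg Quotient.out (Quotient.sound ⟨s, rfl⟩)
    -- Independently chosen primitives need not be equivariant, so only those at orbit
    -- representatives are kept and translated along each orbit.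
    let h : X → (ℕ → G) → ZMod p := fun x y => k (o x) (fun i => (σ x : G)⁻¹ * y i)
    have hh : ∀ (s : S) x y, h (s • x) (fun i => s * y i) = h x y := by
      intro s x y
      -- The discrepancy between two translations to the same point lies in the stabilizer, under
      -- which the primitive is invariant.
      have hst : (σ (s • x))⁻¹ * s * σ x ∈ MulAction.stabilizer S (o x) := by
        rw [MulAction.mem_stabilizer_iff, mul_smul, hoσ, mul_smul, inv_smul_eq_iff, ← hos s x, hoσ]
      have := (hk (o x)).1 _ ⟨_, hst, rfl⟩ (fun i => (σ x : G)⁻¹ * y i)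
      simp only [h, hos]
      rw [← this]
      simp [mul_assoc]
    refine ⟨∑ x, h x, ⟨fun a ha y => ?_, ?_⟩, ?_⟩
    · rw [Finset.sum_apply, Finset.sum_apply]
      refine (Fintype.sum_equiv (MulAction.toPerm (⟨a, ha⟩ : S)) _ _ fun x => ?_).symm
      exact (hh ⟨a, ha⟩ x y).symm
    · refine (Submodule.sum_mem (RelCochain p (⊥ : Subgroup G) n) fun x _ => ?_).2
      exact translate_mem (hk (o x)) _ fun b hb => by simp [Subgroup.mem_bot.mp hb, one_mem]
    · rw [map_sum]
      refine Finset.sum_congr rfl fun x _ => ?_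
      refine (seqD_translate n (k (o x)) (σ x : G)⁻¹).trans (funext fun y => ?_)
      rw [hkf, ← hf (σ x), hoσ]
      simp

end Transfer

/-! ### Sylow theory -/

/-- The normal subgroup `M ≤ L` acts trivially on `U ⧸ L`, so `B` acts through a `p`-group on a
finite set of size prime to `p` and therefore fixes a coset `u L`. -/
theorem exists_conj_le_of_not_dvd_index {p : ℕ} [Fact p.Prime] {G : Type*} [Group G]
    {U L M B : Subgroup G} [M.Normal] (hLU : L ≤ U) (hML : M ≤ L) (hL : ¬ p ∣ L.index) (hBU : B ≤ U)
    (hB : ∀ b ∈ B, ∃ k : ℕ, b ^ p ^ k ∈ M) : ∃ u ∈ U, ∀ b ∈ B, u⁻¹ * b * u ∈ L := by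
  have hrel : ¬ p ∣ L.relIndex U := fun h =>
    hL (h.trans ⟨U.index, (Subgroup.relIndex_mul_index hLU).symm⟩)
  have h0 : L.relIndex U ≠ 0 := fun h => hrel (h ▸ dvd_zero p)
  let X := U ⧸ L.subgroupOf U
  have : Finite X := Nat.finite_of_card_ne_zero h0
  let H := (MulAction.toPermHom (B.subgroupOf U) X).range
  have hH : IsPGroup p H := by
    rintro ⟨_, b, rfl⟩
    obtain ⟨k, hk⟩ := hB b b.2
    refine ⟨k, Subtype.ext (Equiv.ext fun x => ?_)⟩
    obtain ⟨u, rfl⟩ := QuotientGroup.mk_surjective x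
    rw [SubmonoidClass.coe_pow, ← map_pow]
    refine (QuotientGroup.eq.mpr ?_ : (((b ^ p ^ k : B.subgroupOf U) : U) * u : X) = (u : X))
    rw [Subgroup.mem_subgroupOf]
    refine hML ?_
    have := Subgroup.Normal.conj_mem ‹M.Normal› _ (inv_mem hk) (u : G)⁻¹
    simpa [mul_assoc] using this
  have hfix := hH.card_modEq_card_fixedPoints X
  have : (MulAction.fixedPoints H X).Nonempty := by
    by_contra hne
    rw [Set.not_nonempty_iff_eq_empty.mp hne] at hfix
    exact hrel ((Nat.modEq_zero_iff_dvd).mp (by simpa [X, Subgroup.relIndex, Subgroup.index] using hfix))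
  obtain ⟨x, hx⟩ := this
  obtain ⟨u, rfl⟩ := QuotientGroup.mk_surjective x
  refine ⟨u, u.2, fun b hb => ?_⟩
  have h1 : ((⟨b, hBU hb⟩ * u : U) : X) = (u : X) := hx ⟨_, ⟨⟨b, hBU hb⟩, hb⟩, rfl⟩
  have h2 := inv_mem (QuotientGroup.eq.mp h1)
  rw [Subgroup.mem_subgroupOf] at h2
  simpa [mul_assoc] using h2

section Sylow

variable {p : ℕ} [Fact p.Prime] {G : Type*} [Group G] [TopologicalSpace G]
  [IsTopologicalGroup G] [CompactSpace G] [TotallyDisconnectedSpace G]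

/-- The stabilizer in a Sylow pro-`p` subgroup `S` of a coset of `S N` is conjugate into `S` by a
representative of that coset. -/
theorem exists_mk_eq_conj_mem {S : Subgroup G} (hS : IsSylowProP p S) (N : OpenNormalSubgroup G)
    (q : G ⧸ (S ⊔ N.toSubgroup)) :
    ∃ g : G, (g : G ⧸ (S ⊔ N.toSubgroup)) = q ∧ ∀ s ∈ S, s • q = q → g⁻¹ * s * g ∈ S := by
  -- `C M` collects the representatives that work modulo `M`. These sets are closed, nonempty by
  -- finite Sylow theory and directed, so compactness yields one that works for all `M`.
  let C : OpenNormalSubgroup G → Set G := fun M =>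
    {g | (g : G ⧸ (S ⊔ N.toSubgroup)) = q ∧
      ∀ s ∈ S, s • q = q → g⁻¹ * s * g ∈ S ⊔ M.toSubgroup}
  have hopen : ∀ M : OpenNormalSubgroup G, IsOpen ((S ⊔ M.toSubgroup : Subgroup G) : Set G) :=
    fun M => Subgroup.isOpen_mono le_sup_right M.isOpen'
  have hmono : ∀ M M' : OpenNormalSubgroup G, M ≤ M' → C M ⊆ C M' := fun M M' h g hg =>
    ⟨hg.1, fun s hs hq => sup_le_sup_left (show M.toSubgroup ≤ M'.toSubgroup from h) S
      (hg.2 s hs hq)⟩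
  have hclosed : ∀ M, IsClosed (C M) := by
    intro M
    have hcl := Subgroup.isClosed_of_isOpen _ (hopen M)
    have : DiscreteTopology (G ⧸ (S ⊔ N.toSubgroup)) :=
      QuotientGroup.discreteTopology (hopen N)
    refine IsClosed.and ?_ ?_
    · exact (isClosed_discrete {q}).preimage QuotientGroup.continuous_mk
    · simp only [Set.ofPred_forall]
      exact isClosed_iInter fun s => isClosed_iInter fun _ => isClosed_iInter fun _ =>
        hcl.preimage (by fun_prop)
  have hne : ∀ M, (C M).Nonempty := by
    intro M
    obtain ⟨g, rfl⟩ := QuotientGroup.mk_surjective q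
    -- Intersecting with `N` puts `S M'` inside `S N`, where the conjugating element must lie to
    -- preserve the coset.
    let M' := M ⊓ N
    have hp : ∀ s ∈ S, ∃ k : ℕ, s ^ p ^ k ∈ M'.toSubgroup := by
      intro s hs
      obtain ⟨k, hk⟩ := hS.isProP (M'.toSubgroup.subgroupOf S) inferInstance
        (M'.isOpen'.preimage continuous_subtype_val)
      refine ⟨k, ?_⟩
      have := Subgroup.pow_index_mem (M'.toSubgroup.subgroupOf S) ⟨s, hs⟩
      rwa [hk] at this
    let B := (S ⊓ MulAction.stabilizer G (g : G ⧸ (S ⊔ N.toSubgroup))).map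
      (MulAut.conj g⁻¹).toMonoidHom
    have hBU : B ≤ S ⊔ N.toSubgroup := by
      rintro _ ⟨s, ⟨hs, hq⟩, rfl⟩
      have := inv_mem (QuotientGroup.eq.mp (MulAction.mem_stabilizer_iff.mp hq))
      simpa [mul_assoc] using this
    have hB : ∀ b ∈ B, ∃ k : ℕ, b ^ p ^ k ∈ M'.toSubgroup := by
      rintro _ ⟨s, ⟨hs, hq⟩, rfl⟩
      obtain ⟨k, hk⟩ := hp s hs
      refine ⟨k, ?_⟩
      rw [← map_pow]
      simpa using M'.isNormal'.conj_mem _ hk g⁻¹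
    obtain ⟨u, hu, h⟩ := exists_conj_le_of_not_dvd_index
      (sup_le_sup_left (show M'.toSubgroup ≤ N.toSubgroup from
        (inf_le_right : M ⊓ N ≤ N)) S) le_sup_right
      (hS.not_dvd_index _ inferInstance M'.isOpen') hBU hB
    refine ⟨g * u, ?_, fun s hs hq => ?_⟩
    · exact QuotientGroup.eq.mpr (by simpa using hu)
    · have := h _ ⟨s, ⟨hs, hq⟩, rfl⟩
      refine sup_le_sup_left (show M'.toSubgroup ≤ M.toSubgroup from
        (inf_le_left : M ⊓ N ≤ M)) S ?_
      simpa [mul_assoc] using this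
  have : Nonempty (OpenNormalSubgroup G) := ⟨N⟩
  obtain ⟨g, hg⟩ := IsCompact.nonempty_iInter_of_directed_nonempty_isCompact_isClosed C
    (fun M M' => ⟨M ⊓ M', hmono _ _ inf_le_left, hmono _ _ inf_le_right⟩) hne
    (fun M => (hclosed M).isCompact) hclosed
  rw [Set.mem_iInter] at hg
  refine ⟨g, (hg N).1, fun s hs hq => ?_⟩
  by_contra hx
  -- As `S` is closed, membership in `S M` for every open normal `M` forces membership in `S`.
  have ho : IsOpen {m : G | g⁻¹ * s * g * m⁻¹ ∉ S} :=
    (hS.isClosed.preimage (by fun_prop : Continuous fun m : G => g⁻¹ * s * g * m⁻¹)).isOpen_compl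
  obtain ⟨M, hM⟩ := ProfiniteGrp.exist_openNormalSubgroup_sub_open_nhds_of_one ho (by simpa using hx)
  obtain ⟨t, ht, m, hm, h⟩ := Subgroup.mem_sup_of_normal_right.mp ((hg M).2 s hs hq)
  refine hM hm ?_
  rw [← h]
  simpa using ht

end Sylow

end ContCoh

namespace ContCoh

/-! ### Functoriality in degrees -/

section Functoriality

variable {p : ℕ} {G K L : Type*} [Group G] [TopologicalSpace G] [Group K] [TopologicalSpace K]
  [Group L] [TopologicalSpace L]

theorem HMap_of (φ : K →ₜ* G) (n : ℕ) (a : Hn p G n) :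
    HMap p φ (DirectSum.of (Hn p G) n a) = DirectSum.of (Hn p K) n (HnMap φ n a) :=
  DirectSum.toSemiring_of _ _ _ n a

theorem HMap_apply (φ : K →ₜ* G) (x : H p G) (n : ℕ) : HMap p φ x n = HnMap φ n (x n) := by
  induction x using DirectSum.induction_on with
  | zero => rw [map_zero, DirectSum.zero_apply, DirectSum.zero_apply, map_zero]
  | of m a =>
    rw [HMap_of]
    by_cases h : m = n
    · subst h
      rw [DirectSum.of_eq_same, DirectSum.of_eq_same]
    · rw [DirectSum.of_eq_of_ne _ _ _ (Ne.symm h), DirectSum.of_eq_of_ne _ _ _ (Ne.symm h), map_zero]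
  | add x y hx hy => rw [map_add, DirectSum.add_apply, DirectSum.add_apply, map_add, hx, hy]

theorem HnMap_cls (φ : K →ₜ* G) {n : ℕ} (f : Cocycle p G n) :
    HnMap φ n (cls f) = cls (cocycleMap φ n f) := rfl

theorem HMap_comp (φ : K →ₜ* G) (ψ : L →ₜ* K) (x : H p G) :
    HMap p (φ.comp ψ) x = HMap p ψ (HMap p φ x) := by
  refine DFinsupp.ext fun n => ?_
  rw [HMap_apply, HMap_apply, HMap_apply]
  obtain ⟨f, hf⟩ := cls_surjective (x n)
  rw [← hf]
  rfl

end Functoriality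

/-! ### Restriction to, and extension from, a closed subgroup -/

section Restriction

set_option linter.unusedSectionVars false

variable {p : ℕ} {G : Type*} [Group G] [TopologicalSpace G]
  [IsTopologicalGroup G] [CompactSpace G] [TotallyDisconnectedSpace G]

theorem ev_mem_relCochain {n : ℕ} (c : Cochain p G n) : ev c ∈ RelCochain p ⊤ n :=
  ⟨fun a _ y => c.2.2 a fun i => y i,
    exists_openNormal_invariant (ContinuousMonoidHom.id G) (fun _ _ h => h) c⟩

theorem seqD_ev {n : ℕ} (c : Cocycle p G n) : seqD n (ev c.1) = 0 :=
  funext fun y => (ev_d c.1 y).symm.trans (by rw [LinearMap.mem_ker.mp c.2]; rfl)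

/-- Conjugate homomorphisms induce the same map in cohomology. -/
theorem HMap_eq_of_conj {K : Type*} [Group K] [TopologicalSpace K] (φ ψ : K →ₜ* G) (g : G)
    (h : ∀ k, φ k = g * ψ k * g⁻¹) (x : H p G) : HMap p φ x = HMap p ψ x := by
  refine DFinsupp.ext fun n => ?_
  rw [HMap_apply, HMap_apply]
  obtain ⟨f, hf⟩ := cls_surjective (x n)
  rw [← hf, HnMap_cls, HnMap_cls, eq_comm, cls_eq_cls]
  -- Invariance under `g` turns conjugation by `g` into right translation by `g⁻¹`.
  refine mem_coboundaries_of_relBd ψ (A := ⊤) (fun _ => trivial)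
    (sub_translate_right_mem_relBd (ev_mem_relCochain f.1) (seqD_ev f) g⁻¹) fun y => ?_
  refine congrArg₂ (fun a b : ZMod p => a - b) rfl ?_
  refine Eq.trans (congrArg f.1.1 (funext fun i => ?_)) (f.1.2.2 g _)
  rw [h, mul_assoc]

theorem range_contSubtype (S : Subgroup G) : S.contSubtype.toMonoidHom.range = S :=
  S.range_subtype

theorem card_quotient_ne_zero [Fact p.Prime] {S : Subgroup G} (hS : IsSylowProP p S)
    (N : OpenNormalSubgroup G) : (Nat.card (G ⧸ (S ⊔ N.toSubgroup)) : ZMod p) ≠ 0 := by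
  rw [Ne, ZMod.natCast_eq_zero_iff]
  exact hS.not_dvd_index _ inferInstance N.isOpen'

theorem finite_quotient_sup (S : Subgroup G) (N : OpenNormalSubgroup G) :
    Finite (G ⧸ (S ⊔ N.toSubgroup)) :=
  Subgroup.quotient_finite_of_isOpen _ (Subgroup.isOpen_mono le_sup_right N.isOpen')

/-- Restriction to a Sylow pro-`p` subgroup is injective. -/
theorem mem_coboundaries_of_restrict [Fact p.Prime] {S : Subgroup G} (hS : IsSylowProP p S) {n : ℕ}
    (f : Cocycle p G n) (h : cochainMap S.contSubtype n f.1 ∈ coboundaries p S n) :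
    f.1 ∈ coboundaries p G n := by
  have : CompactSpace S := isCompact_iff_compactSpace.mp hS.isClosed.isCompact
  have hB : ev f.1 ∈ RelBd p S n := by
    have := mem_relBd_of_coboundaries S.contSubtype Subtype.val_injective
      (RelCochain.anti le_top n (ev_mem_relCochain f.1)) (seqD_ev f) h fun y => rfl
    rwa [range_contSubtype] at this
  refine mem_coboundaries_of_relBd (ContinuousMonoidHom.id G) (A := ⊤) (fun _ => trivial)
    (f := ev f.1) ?_ fun y => rfl
  cases n with
  | zero => exact hB
  | succ n =>
    obtain ⟨k, ⟨hk, N, hN⟩, hkf⟩ := hB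
    have hkU := mem_relCochain_sup hk N hN
    have := finite_quotient_sup S N
    have := Fintype.ofFinite (G ⧸ (S ⊔ N.toSubgroup))
    have hm := card_quotient_ne_zero hS N
    -- The new primitive is the average of the translates of `k`. Its coboundary is `ev f.1`, since
    -- every translate of this `G`-invariant cochain is itself.
    refine ⟨(Nat.card (G ⧸ (S ⊔ N.toSubgroup)) : ZMod p)⁻¹ •
      ∑ q : G ⧸ (S ⊔ N.toSubgroup), cosetTranslate k q,
      Submodule.smul_mem _ _ (sum_cosetTranslate_mem hkU), ?_⟩
    have hc : ∀ q : G ⧸ (S ⊔ N.toSubgroup), cosetTranslate (ev f.1) q = ev f.1 := fun q =>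
      funext fun y => (ev_mem_relCochain f.1).1 _ trivial y
    rw [map_smul, seqD_sum_cosetTranslate, hkf, Finset.sum_congr rfl fun q _ => hc q,
      Finset.sum_const, Finset.card_univ, ← Nat.card_eq_fintype_card, ← Nat.cast_smul_eq_nsmul (ZMod p),
      inv_smul_smul₀ hm]

/-- A continuous cocycle on a closed subgroup extends to a cocycle on the whole group that is
invariant under an open neighbourhood of the subgroup. -/
theorem exists_extension {S : Subgroup G} (hS : IsClosed (S : Set G)) {n : ℕ} (c : Cocycle p S n) :
    ∃ (N : OpenNormalSubgroup G) (F : (ℕ → G) → ZMod p), F ∈ RelCochain p (S ⊔ N.toSubgroup) n ∧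
      seqD n F = 0 ∧ ∀ y : ℕ → S, F (fun i => y i) = ev c.1 y := by
  have : CompactSpace S := isCompact_iff_compactSpace.mp hS.isCompact
  obtain ⟨N, hN⟩ := exists_openNormal_invariant S.contSubtype Subtype.val_injective c.1
  obtain ⟨r, h1, h2, h3⟩ := exists_retraction S.subtype N.toSubgroup
  refine ⟨N, fun y => ev c.1 fun i => r (y i), mem_relCochain_sup ?_ N ?_, ?_, fun y => ?_⟩
  · intro s hs y
    refine (hN _ (fun i => (⟨s, hs⟩ : S) * r (y i)) fun i _ => ?_).trans
      (c.1.2.2 ⟨s, hs⟩ fun i : Fin (n + 1) => r (y i))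
    have : ((⟨s, hs⟩ : S) * (r (y i) : S) : G)⁻¹ * r (s * y i) ∈ N := h2 ⟨s, hs⟩ (y i)
    have := inv_mem this
    rw [mul_inv_rev, inv_inv] at this
    exact this
  · exact fun y z w => ev_congr _ fun i hi => h1 _ _ (w i (by omega))
  · funext y
    have := ev_d c.1 fun i => r (y i)
    rw [LinearMap.mem_ker.mp c.2] at this
    simp only [face_comp] at this
    exact this.symm
  · refine (hN _ _ fun i _ => ?_).symm
    exact h3 (y i)

end Restriction

end ContCoh

/-! ### Stable elements and the image of restriction -/

namespace ProFusion

set_option linter.unusedSectionVars false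

open ContCoh CategoryTheory

variable {p : ℕ} {G : Type*} [Group G] [TopologicalSpace G]
  [IsTopologicalGroup G]

/-- The stabilizer in `S` of a coset of `S N`, as an object of the fusion system. -/
def stabilizer (S : Subgroup G) (N : OpenNormalSubgroup G) (q : G ⧸ (S ⊔ N.toSubgroup)) :
    {P : ProFusion S // IsOpen (P.grp : Set S)} :=
  have ho : IsOpen (MulAction.stabilizer S q : Set S) := by
    refine Subgroup.isOpen_mono (H₁ := N.toSubgroup.subgroupOf S) (fun s hs => ?_)
      (N.isOpen'.preimage continuous_subtype_val)
    obtain ⟨g, rfl⟩ := QuotientGroup.mk_surjective q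
    refine QuotientGroup.eq.mpr (Subgroup.mem_sup_right ?_)
    have := N.isNormal'.conj_mem _ (inv_mem hs) g⁻¹
    simpa [mul_assoc] using this
  ⟨⟨⟨MulAction.stabilizer S q, Subgroup.isClosed_of_isOpen _ ho⟩⟩, ho⟩

/-- The morphism `x ↦ g⁻¹ x g` from `P` to `S`. -/
def conjHom {S : Subgroup G} (P : ProFusion S) (g : G) (h : ∀ x : P.grp, g⁻¹ * (x : S) * g ∈ S) :
    P ⟶ top S :=
  ⟨⟨⟨⟨fun x => ⟨⟨g⁻¹ * (x : S) * g, h x⟩, trivial⟩, by simp; rfl⟩, fun x y => by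
      apply Subtype.ext
      apply Subtype.ext
      simp [mul_assoc]⟩, by
      refine Continuous.subtype_mk (Continuous.subtype_mk ?_ _) _
      exact (continuous_const.mul (continuous_subtype_val.comp continuous_subtype_val)).mul
        continuous_const⟩, g⁻¹, fun x => by rw [inv_inv]; rfl⟩

variable [CompactSpace G] [TotallyDisconnectedSpace G]

/-- A cocycle on `S` whose class is stable on open subgroups is cohomologous to a restriction. -/
theorem exists_restrict_sub_mem [Fact p.Prime] {S : Subgroup G} (hS : IsSylowProP p S) {n : ℕ}
    (c : Cocycle p S n)
    (hc : ∀ P : ProFusion S, IsOpen (P.grp : Set S) → ∀ φ : P ⟶ top S,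
      cochainMap (toS φ) n c.1 - cochainMap P.incl n c.1 ∈ coboundaries p P.grp n) :
    ∃ e : Cocycle p G n, cochainMap S.contSubtype n e.1 - c.1 ∈ coboundaries p S n := by
  obtain ⟨N, F, hF, hd, hFc⟩ := exists_extension hS.isClosed c
  have := finite_quotient_sup S N
  have := Fintype.ofFinite (G ⧸ (S ⊔ N.toSubgroup))
  have hm := card_quotient_ne_zero hS N
  have hFS : F ∈ RelCochain p S n := RelCochain.anti le_sup_left n hF
  have key : ∀ q : G ⧸ (S ⊔ N.toSubgroup), cosetTranslate F q - F ∈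
      RelBd p ((MulAction.stabilizer S q).map S.subtype) n := by
    intro q
    obtain ⟨g, hg, hgS⟩ := exists_mk_eq_conj_mem hS N q
    have hA : ∀ a ∈ (MulAction.stabilizer S q).map S.subtype, g⁻¹ * a * g ∈ S := by
      rintro _ ⟨s, hs, rfl⟩
      exact hgS s s.2 hs
    have hAS : (MulAction.stabilizer S q).map S.subtype ≤ S := by
      rintro _ ⟨s, hs, rfl⟩
      exact s.2
    have e : cosetTranslate F q = fun y => F (fun i => g⁻¹ * y i) := by
      funext y
      rw [← hg, cosetTranslate_mk hF.1]
    have hT := translate_mem hFS g hA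
    have hdT : seqD n (fun y => F (fun i => g⁻¹ * y i)) = 0 := by
      rw [seqD_translate, hd]
      rfl
    -- The translate is first compared with the conjugate `y ↦ F (g⁻¹ y g)`, which on the stabilizer
    -- restricts to the pullback of `c` under the fusion morphism `x ↦ g⁻¹ x g`.
    rw [e, ← sub_add_sub_cancel _ (fun y => F (fun i => g⁻¹ * (y i * g)))]
    refine Submodule.add_mem _ (sub_translate_right_mem_relBd hT hdT g) ?_
    let P := (stabilizer S N q).1
    have : CompactSpace S := isCompact_iff_compactSpace.mp hS.isClosed.isCompact
    have : CompactSpace P.grp := isCompact_iff_compactSpace.mp P.grp.isClosed'.isCompact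
    have : IsTopologicalGroup P.grp := inferInstanceAs (IsTopologicalGroup P.grp.toSubgroup)
    let ψ : P.grp →ₜ* G := S.contSubtype.comp P.incl
    have hψ : ψ.toMonoidHom.range = (MulAction.stabilizer S q).map S.subtype := by
      ext x
      constructor
      · rintro ⟨s, rfl⟩
        exact ⟨s, s.2, rfl⟩
      · rintro ⟨s, hs, rfl⟩
        exact ⟨⟨s, hs⟩, rfl⟩
    let φ : P ⟶ top S := conjHom P g fun x => hgS _ x.1.2 x.2
    have hf := Submodule.sub_mem _ (translate_right_mem hT g) (RelCochain.anti hAS n hFS)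
    rw [← hψ] at hf ⊢
    refine mem_relBd_of_coboundaries ψ (Subtype.val_injective.comp Subtype.val_injective) hf ?_
      (hc P (stabilizer S N q).2 φ) fun y => ?_
    · rw [map_sub, hd, sub_zero]
      refine funext fun y => (seqD_comp n (fun y => F fun i => g⁻¹ * y i) (· * g) y).trans ?_
      rw [hdT]
      rfl
    · refine congrArg₂ (· - ·) ((hFc fun i => toS φ (y i)).symm.trans ?_)
        (hFc fun i => P.incl (y i)).symm
      exact congrArg F (funext fun i => mul_assoc _ _ _)
  -- Modulo `S`-coboundaries, the transfer of `F` is thus the index times `F`.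
  have hsum := sum_mem_relBd (S := S) (fun q : G ⧸ (S ⊔ N.toSubgroup) => cosetTranslate F q - F)
    (fun s q y => congrArg₂ (· - ·) (cosetTranslate_smul hF.1 (s : G) q y) (hFS.1 s s.2 y)) key
  rw [Finset.sum_sub_distrib, Finset.sum_const, Finset.card_univ, ← Nat.card_eq_fintype_card,
    ← Nat.cast_smul_eq_nsmul (ZMod p)] at hsum
  have hB := Submodule.smul_mem _ (Nat.card (G ⧸ (S ⊔ N.toSubgroup)) : ZMod p)⁻¹ hsum
  rw [smul_sub, inv_smul_smul₀ hm] at hB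
  have htr := Submodule.smul_mem _ (Nat.card (G ⧸ (S ⊔ N.toSubgroup)) : ZMod p)⁻¹
    (sum_cosetTranslate_mem hF)
  have hev := ev_pullback (ContinuousMonoidHom.id G) (fun _ => Subgroup.mem_top _) htr
  refine ⟨⟨pullback (ContinuousMonoidHom.id G) (fun _ => Subgroup.mem_top _) htr,
    LinearMap.mem_ker.mpr (cochain_ext fun y => ?_)⟩,
    mem_coboundaries_of_relBd S.contSubtype (fun s => s.2) hB fun y => ?_⟩
  · rw [ev_d_eq_seqD _ hev, map_smul, seqD_sum_cosetTranslate, hd]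
    simp [cosetTranslate, ev_zero]
  · exact congrArg₂ (· - ·) (hev fun i => S.contSubtype (y i)) (hFc y).symm

/-- A fusion morphism followed by `S → G` is conjugate in `G` to the inclusion, so both induce the
same map on classes coming from `G`. -/
theorem range_le_stable (S : Subgroup G) (x : H p G) : HMap p S.contSubtype x ∈ stable p S := by
  intro P _ φ
  rw [← HMap_comp, ← HMap_comp]
  obtain ⟨g, hg⟩ := φ.2
  exact HMap_eq_of_conj _ _ g hg x

theorem stable_le_stableOpen (S : Subgroup G) : stable p S ≤ stableOpen p S :=
  fun _ hx P _ φ => hx P trivial φ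

theorem stableOpen_le_range [Fact p.Prime] {S : Subgroup G} (hS : IsSylowProP p S) :
    stableOpen p S ≤ (HMap p S.contSubtype).range := by
  intro x hx
  classical
  rw [← DirectSum.sum_support_of x]
  refine sum_mem fun n _ => ?_
  obtain ⟨c, hcx⟩ := cls_surjective (x n)
  obtain ⟨e, he⟩ := exists_restrict_sub_mem hS c fun P hP φ => by
    have := DFunLike.congr_fun (hx P hP φ) n
    rw [HMap_apply, HMap_apply, ← hcx, HnMap_cls, HnMap_cls, cls_eq_cls] at this
    exact this
  refine ⟨DirectSum.of (Hn p G) n (cls e), ?_⟩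
  rw [HMap_of, ← hcx, HnMap_cls]
  exact congrArg _ (cls_eq_cls.mpr he)

theorem restrict_injective [Fact p.Prime] {S : Subgroup G} (hS : IsSylowProP p S) :
    Function.Injective (HMap p S.contSubtype) := by
  refine (injective_iff_map_eq_zero _).mpr fun x hx => DFinsupp.ext fun n => ?_
  obtain ⟨f, hf⟩ := cls_surjective (x n)
  have h := DFunLike.congr_fun hx n
  have h0 : (0 : Hn p S n) = cls 0 := rfl
  rw [HMap_apply, ← hf, HnMap_cls, DirectSum.zero_apply, h0, cls_eq_cls] at h
  rw [← hf]
  refine (cls_eq_cls (h := 0)).mpr ?_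
  simp only [Submodule.coe_zero, sub_zero] at h ⊢
  exact mem_coboundaries_of_restrict hS f h

end ProFusion

theorem mainTheorem2 (p : ℕ) [Fact p.Prime] (G : Type*) [Group G] [TopologicalSpace G]
    [IsTopologicalGroup G] [CompactSpace G] [TotallyDisconnectedSpace G]
    (S : Subgroup G) (hS : IsSylowProP p S) :
    (∃ e : ContCoh.H p G ≃+* ProFusion.stable p S,
      ∀ x : ContCoh.H p G, (e x : ContCoh.H p S) = ContCoh.HMap p S.contSubtype x) ∧
    ProFusion.stable p S = ProFusion.stableOpen p S := by
  have hle : (ContCoh.HMap p S.contSubtype).range ≤ ProFusion.stable p S := by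
    rintro _ ⟨x, rfl⟩
    exact ProFusion.range_le_stable S x
  refine ⟨⟨RingEquiv.ofBijective ((ContCoh.HMap p S.contSubtype).codRestrict (ProFusion.stable p S)
    (ProFusion.range_le_stable S)) ⟨fun x y h => ProFusion.restrict_injective hS
      (congrArg Subtype.val h), fun y => ?_⟩, fun x => rfl⟩,
    le_antisymm (ProFusion.stable_le_stableOpen S) ((ProFusion.stableOpen_le_range hS).trans hle)⟩
  obtain ⟨x, hx⟩ := ProFusion.stableOpen_le_range hS (ProFusion.stable_le_stableOpen S y.2)
  exact ⟨x, Subtype.ext hx⟩
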